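/- Let $1\le k\le\infty$, and let $M$ be a real $C^k$ manifold (Hausdorff, second countable, without boundary, not necessarily connected) of dimension $d\ge 1$. Let $\mathcal B$ be one of the following spaces of real-valued functions: (a) $\mathcal B=C^k(M,\mathbb R)$, the $C^k$ functions on $M$; (b) $\mathcal B=C^k_c(M,\mathbb R)$, the compactly supported $C^k$ functions on $M$; (c) $\mathcal B=\mathcal S_{\mathbb R}(n)$ with $n\ge 1$, the real-valued Schwartz functions on $\mathbb R^n$; in this case $M=\mathbb R^n$ and $k=\infty$. Let $T:\mathcal B\to\mathcal B$ be a bijection that is multiplicative, i.e. $T(fg)=Tf\cdot Tg$ pointwise for all $f,g\in\mathcal B$; no linearity or continuity of $T$ is assumed. Then there exists a $C^k$-diffeomorphism $u:M\to M$ such that $$(Tf)(u(x))=f(x)\qquad\text{for all } f\in\mathcal B,\ x\in M.$$ In particular, $T$ is $\mathbb R$-linear. -/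

import Mathlib

open scoped Manifold ContDiff SchwartzMap

/-- The space `C^k_c(M, ℝ)` of compactly supported real-valued `C^k` functions on `M`, as a
(non-unital) subalgebra of `C^k(M, ℝ)` with its pointwise operations. -/
def CompactlySupportedCk (k : ℕ∞) (d : ℕ) (M : Type*) [TopologicalSpace M]
    [ChartedSpace (EuclideanSpace ℝ (Fin d)) M] :
    NonUnitalSubalgebra ℝ C^k⟮𝓡 d, M; 𝓘(ℝ, ℝ), ℝ⟯ where
  carrier := {f | HasCompactSupport (f : M → ℝ)}
  zero_mem' := HasCompactSupport.zero
  add_mem' := fun hf hg => HasCompactSupport.add hf hg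
  mul_mem' := fun hf _ => HasCompactSupport.mul_right hf
  smul_mem' := fun c f hf => by
    refine HasCompactSupport.mono hf fun x hx hfx => hx ?_
    have h0 : f x = 0 := hfx
    simp [h0]

/-- The pointwise product of two real-valued Schwartz functions on `ℝⁿ`. -/
noncomputable def schwartzMul {n : ℕ} (f g : 𝓢(EuclideanSpace ℝ (Fin n), ℝ)) :
    𝓢(EuclideanSpace ℝ (Fin n), ℝ) :=
  SchwartzMap.pairing (ContinuousLinearMap.mul ℝ ℝ) f g

theorem schwartzMul_apply {n : ℕ} (f g : 𝓢(EuclideanSpace ℝ (Fin n), ℝ))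
    (x : EuclideanSpace ℝ (Fin n)) : schwartzMul f g x = f x * g x := rfl

/-! Everything reduces to compactly supported functions. Compactness of the support can be expressed
by multiplication alone, so `T` preserves it (`hasCompactSupport_iff_not_exists_glue`,
`mem_range_toSchwartz_iff`), and multiplying by a bump recovers `T` on the larger space.

There, relations `e * e' = e'` between bumps survive `T` and produce a homeomorphism `u`
(`exists_isPointMap`) such that the germ of `T f` at `u x` depends only on the germ of `f` at `x`.
The crux is that only the value `f x` matters (`apply_congr`). If `f x = 1` but `T f (u x) > 1`, a
single `H` with germs `2^(-(n+1)^2) * f^((n+1)^4)` at points `xₙ → x` has images blowing up at `u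
xₙ`, against continuity. Such an `H` is of class `C^k` because the scalars decay faster than the
derivatives of powers and cutoffs grow (`exists_contDiff_eventuallyEq_exp`).

Hence `T f (u x) = τ_x (f x)` with `τ_x` multiplicative. A similar gluing makes `τ_x` monotone on
positive reals, so `τ_x t = t^p(x)` there, with `p` continuous. A quotient of logarithms cancels `p`
and shows that `u` is a diffeomorphism. Finally, a coordinate function with a simple zero at `x`
forces `p(x) ≥ 1`; the same bound for the inverse of `T` gives `p = 1`. -/

open Set Filter Topology

/-! ### Prescribing germs by compactly supported functions -/

section Localization

variable {k : ℕ∞} {d : ℕ} {M : Type*} [TopologicalSpace M]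
  [ChartedSpace (EuclideanSpace ℝ (Fin d)) M]

namespace CompactlySupportedCk

theorem contMDiff_coe (f : CompactlySupportedCk k d M) : ContMDiff (𝓡 d) 𝓘(ℝ, ℝ) k f.1 :=
  f.1.contMDiff

theorem continuous_coe (f : CompactlySupportedCk k d M) : Continuous f.1 :=
  f.1.contMDiff.continuous

theorem hasCompactSupport_coe (f : CompactlySupportedCk k d M) : HasCompactSupport f.1 := f.2

@[simp] theorem mul_apply (f g : CompactlySupportedCk k d M) (x : M) :
    (f * g).1 x = f.1 x * g.1 x := rfl


theorem ext_apply {f g : CompactlySupportedCk k d M} (h : ∀ x, f.1 x = g.1 x) : f = g :=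
  Subtype.ext (ContMDiffMap.ext h)

/-- The compactly supported function with given underlying map. -/
def mk (f : M → ℝ) (hf : ContMDiff (𝓡 d) 𝓘(ℝ, ℝ) k f) (hc : HasCompactSupport f) :
    CompactlySupportedCk k d M := ⟨⟨f, hf⟩, hc⟩

@[simp] theorem mk_apply (f : M → ℝ) (hf : ContMDiff (𝓡 d) 𝓘(ℝ, ℝ) k f)
    (hc : HasCompactSupport f) (x : M) : (mk f hf hc).1 x = f x := rfl

variable [T2Space M] [IsManifold (𝓡 d) k M]

/-- Bump functions on a manifold which is only of class `C^k`. -/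
theorem exists_bump {U : Set M} {x : M} (hU : U ∈ 𝓝 x) :
    ∃ e : CompactlySupportedCk k d M, e.1 =ᶠ[𝓝 x] 1 ∧ tsupport e.1 ⊆ U := by
  obtain ⟨f, -, hfU⟩ := (SmoothBumpFunction.nhds_basis_tsupport (I := 𝓡 d) x).mem_iff.1 hU
  refine ⟨mk f ?_ f.hasCompactSupport, f.eventuallyEq_one, hfU⟩
  refine contMDiff_of_tsupport fun y hy => ?_
  have hy' : y ∈ (chartAt (EuclideanSpace ℝ (Fin d)) x).source :=
    f.tsupport_subset_chartAt_source hy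
  refine ContMDiffAt.congr_of_eventuallyEq ?_ (f.eqOn_source.eventuallyEq_of_mem <|
    (chartAt (EuclideanSpace ℝ (Fin d)) x).open_source.mem_nhds hy')
  exact f.contDiffAt.contMDiffAt.comp _ (contMDiffAt_extChartAt' hy')

/-- Every germ of a `C^k` function is the germ of a compactly supported one. -/
theorem exists_eventuallyEq {U : Set M} {x : M} (hU : U ∈ 𝓝 x) {F : M → ℝ}
    (hF : ContMDiffOn (𝓡 d) 𝓘(ℝ, ℝ) k F U) :
    ∃ g : CompactlySupportedCk k d M, g.1 =ᶠ[𝓝 x] F := by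
  obtain ⟨e, he, heU⟩ := exists_bump (k := k) (d := d) (interior_mem_nhds.2 hU)
  refine ⟨mk (fun y => e.1 y * F y) ?_ (hasCompactSupport_coe e).mul_right, ?_⟩
  · refine contMDiff_of_tsupport fun y hy => ?_
    have hy' : y ∈ interior U := heU (tsupport_mul_subset_left hy)
    exact (contMDiff_coe e).contMDiffAt.mul (hF.contMDiffAt (mem_interior_iff_mem_nhds.1 hy'))
  · filter_upwards [he] with y hy
    simp [hy]

theorem exists_eventuallyEq_comp (f : CompactlySupportedCk k d M) {x : M} {V : Set ℝ}
    (hV : IsOpen V) (hx : f.1 x ∈ V) {θ : ℝ → ℝ} (hθ : ContDiffOn ℝ k θ V) :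
    ∃ g : CompactlySupportedCk k d M, g.1 =ᶠ[𝓝 x] fun y => θ (f.1 y) :=
  exists_eventuallyEq (U := f.1 ⁻¹' V)
    ((continuous_coe f).continuousAt.preimage_mem_nhds (hV.mem_nhds hx))
    (hθ.contMDiffOn.comp (contMDiff_coe f).contMDiffOn fun _ h => h)

theorem exists_eventuallyEq_const (x : M) (c : ℝ) :
    ∃ g : CompactlySupportedCk k d M, g.1 =ᶠ[𝓝 x] fun _ => c :=
  exists_eventuallyEq univ_mem contMDiffOn_const

theorem exists_eventuallyEq_pow (f : CompactlySupportedCk k d M) (x : M) (m : ℕ) :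
    ∃ g : CompactlySupportedCk k d M, g.1 =ᶠ[𝓝 x] fun y => f.1 y ^ m :=
  exists_eventuallyEq_comp f isOpen_univ (mem_univ _) (contDiff_id.pow m).contDiffOn

theorem exists_mul_eventuallyEq_one (f : CompactlySupportedCk k d M) {x : M} (hx : f.1 x ≠ 0) :
    ∃ g : CompactlySupportedCk k d M, (f * g).1 =ᶠ[𝓝 x] 1 := by
  obtain ⟨g, hg⟩ := exists_eventuallyEq_comp f isOpen_compl_singleton hx
    (θ := fun t => t⁻¹) (contDiffOn_id.inv fun t ht => ht)
  refine ⟨g, ?_⟩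
  filter_upwards [hg, (continuous_coe f).continuousAt.eventually_ne hx] with y hy h0
  simp [hy, h0]

theorem exists_mul_self_eventuallyEq (f : CompactlySupportedCk k d M) {x : M} (hx : 0 < f.1 x) :
    ∃ g : CompactlySupportedCk k d M, f.1 =ᶠ[𝓝 x] (g * g).1 := by
  obtain ⟨g, hg⟩ := exists_eventuallyEq_comp f isOpen_compl_singleton hx.ne'
    (θ := Real.sqrt) (contDiffOn_id.sqrt fun t ht => ht)
  refine ⟨g, ?_⟩
  filter_upwards [hg, (continuous_coe f).continuousAt.eventually_const_lt hx] with y hy h0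
  simp [hy, Real.mul_self_sqrt h0.le]

end CompactlySupportedCk

end Localization

/-! ### The homeomorphism induced on points, and locality -/

section PointMap

variable {k : ℕ∞} {d : ℕ} {M : Type*} [TopologicalSpace M]
  [ChartedSpace (EuclideanSpace ℝ (Fin d)) M]

open CompactlySupportedCk

/-- `u` carries the germs equal to one at `x` to those at `u x` through `T`. -/
def IsPointMap (T : CompactlySupportedCk k d M ≃* CompactlySupportedCk k d M) (u : M ≃ₜ M) :
    Prop :=
  ∀ e x, e.1 =ᶠ[𝓝 x] 1 ↔ (T e).1 =ᶠ[𝓝 (u x)] 1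

namespace IsPointMap

variable {T : CompactlySupportedCk k d M ≃* CompactlySupportedCk k d M} {u : M ≃ₜ M}

theorem symm (h : IsPointMap T u) : IsPointMap T.symm u.symm := fun e x => by
  rw [h (T.symm e) (u.symm x)]
  simp

theorem apply_eq_one (h : IsPointMap T u) {f : CompactlySupportedCk k d M} {x : M}
    (hf : f.1 =ᶠ[𝓝 x] 1) : (T f).1 (u x) = 1 :=
  ((h f x).1 hf).self_of_nhds

end IsPointMap

variable [T2Space M] [IsManifold (𝓡 d) k M]

theorem CompactlySupportedCk.eq_of_forall_eventuallyEq_one {x y : M}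
    (h : ∀ e : CompactlySupportedCk k d M, e.1 =ᶠ[𝓝 x] 1 → e.1 =ᶠ[𝓝 y] 1) : x = y := by
  by_contra hxy
  obtain ⟨e, he, hU⟩ := exists_bump (k := k) (d := d) (isOpen_compl_singleton.mem_nhds hxy)
  have h1 : e.1 y = 1 := (h e he).self_of_nhds
  exact hU (subset_tsupport e.1 (by simp [h1] : y ∈ Function.support e.1)) rfl

theorem CompactlySupportedCk.exists_mul_eq_right {e : CompactlySupportedCk k d M} {x : M}
    (he : e.1 =ᶠ[𝓝 x] 1) :
    ∃ e' : CompactlySupportedCk k d M, e'.1 =ᶠ[𝓝 x] 1 ∧ e * e' = e' := by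
  obtain ⟨e', he', hU⟩ := exists_bump (k := k) (d := d) he
  refine ⟨e', he', ext_apply fun z => ?_⟩
  by_cases hz : e'.1 z = 0
  · simp [hz]
  · have : e.1 z = 1 := hU (subset_tsupport e'.1 hz)
    simp [this]

/-- The supports of the `T e` are compact, nonempty since `T` is injective and fixes zero, and
directed since products shrink supports; `y` is any common point. -/
theorem exists_point_map (T : CompactlySupportedCk k d M ≃* CompactlySupportedCk k d M) (x : M) :
    ∃ y, ∀ e : CompactlySupportedCk k d M, e.1 =ᶠ[𝓝 x] 1 → (T e).1 =ᶠ[𝓝 y] 1 := by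
  let S := {e : CompactlySupportedCk k d M // e.1 =ᶠ[𝓝 x] 1}
  obtain ⟨e₀, he₀, -⟩ := exists_bump (k := k) (d := d) (univ_mem (f := 𝓝 x))
  have : Nonempty S := ⟨⟨e₀, he₀⟩⟩
  have hne : (⋂ e : S, tsupport (T e.1).1).Nonempty := by
    refine IsCompact.nonempty_iInter_of_directed_nonempty_isCompact_isClosed _ ?_ ?_
      (fun e => hasCompactSupport_coe (T e.1)) fun e => isClosed_tsupport _
    · intro e₁ e₂
      refine ⟨⟨e₁.1 * e₂.1, ?_⟩, ?_, ?_⟩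
      · filter_upwards [e₁.2, e₂.2] with y h₁ h₂
        simp [h₁, h₂]
      · exact (congrArg (fun g => tsupport g.1) (map_mul T e₁.1 e₂.1)).subset.trans
          tsupport_mul_subset_left
      · exact (congrArg (fun g => tsupport g.1) (map_mul T e₁.1 e₂.1)).subset.trans
          tsupport_mul_subset_right
    · intro e
      rw [nonempty_iff_ne_empty, Ne, tsupport_eq_empty_iff]
      intro h
      have h0 : T e.1 = T 0 := by
        have : T 0 = 0 := map_zero T
        rw [this]
        exact ext_apply fun z => congrFun h z
      have h1 : e.1.1 x = 1 := e.2.self_of_nhds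
      rw [T.injective h0] at h1
      simp at h1
  obtain ⟨y, hy⟩ := hne
  rw [mem_iInter] at hy
  have key : ∀ e : CompactlySupportedCk k d M, e.1 =ᶠ[𝓝 x] 1 →
      ∃ e' : CompactlySupportedCk k d M, e'.1 =ᶠ[𝓝 x] 1 ∧
        ∀ z ∈ tsupport (T e').1, (T e).1 z = 1 := by
    intro e he
    obtain ⟨e', he', h⟩ := exists_mul_eq_right he
    refine ⟨e', he', fun z hz => ?_⟩
    refine closure_minimal (t := {z | (T e).1 z = 1}) (fun z hz => ?_)
      (isClosed_eq (continuous_coe _) continuous_const) hz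
    have := congrArg (fun g => g.1 z) (congrArg T h)
    simp only [map_mul, mul_apply] at this
    exact mul_right_cancel₀ hz (this.trans (one_mul _).symm)
  -- One use of `key` gives `T e = 1` only on a closed set containing `y`. The second gives `T e' =
  -- 1` at `y`, so `T e'` is nonzero near `y` and the equality holds on a neighbourhood.
  refine ⟨y, fun e he => ?_⟩
  obtain ⟨e', he', h'⟩ := key e he
  obtain ⟨e'', he'', h''⟩ := key e' he'
  have h1 : (T e').1 y ≠ 0 := by
    rw [h'' y (hy ⟨e'', he''⟩)]
    exact one_ne_zero
  filter_upwards [(continuous_coe (T e')).continuousAt.eventually_ne h1] with z hz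
  exact h' z (subset_tsupport _ hz)

theorem exists_isPointMap (T : CompactlySupportedCk k d M ≃* CompactlySupportedCk k d M) :
    ∃ u : M ≃ₜ M, IsPointMap T u := by
  choose u hu using exists_point_map T
  choose w hw using exists_point_map T.symm
  have hwu : ∀ x, w (u x) = x := fun x =>
    (eq_of_forall_eventuallyEq_one (k := k) (d := d) fun e he => by
      simpa using hw _ _ (hu x e he)).symm
  have huw : ∀ x, u (w x) = x := fun x =>
    (eq_of_forall_eventuallyEq_one (k := k) (d := d) fun e he => by
      simpa using hu _ _ (hw x e he)).symm
  have hcont : ∀ (S : CompactlySupportedCk k d M ≃* CompactlySupportedCk k d M) (a b : M → M),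
      (∀ x e, e.1 =ᶠ[𝓝 x] 1 → (S e).1 =ᶠ[𝓝 (a x)] 1) →
      (∀ x e, e.1 =ᶠ[𝓝 x] 1 → (S.symm e).1 =ᶠ[𝓝 (b x)] 1) → (∀ x, b (a x) = x) →
      Continuous a := by
    intro S a b ha hb hba
    refine continuous_iff_continuousAt.2 fun x U hU => ?_
    obtain ⟨e, he, heU⟩ := exists_bump (k := k) (d := d) hU
    have h1 := hb _ _ he
    rw [hba] at h1
    refine mem_map.2 ?_
    filter_upwards [eventually_eventually_nhds.2 h1] with z hz
    have h2 := ha z _ hz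
    rw [S.apply_symm_apply] at h2
    have h3 : e.1 (a z) = 1 := h2.self_of_nhds
    exact heU (subset_tsupport e.1 (by simp [h3] : a z ∈ Function.support e.1))
  refine ⟨⟨⟨u, w, hwu, huw⟩, hcont T u w hu hw hwu, hcont T.symm w u hw (by simpa using hu) huw⟩,
    fun e x => ⟨hu x e, fun h => ?_⟩⟩
  have h2 := hw _ _ h
  rw [T.symm_apply_apply] at h2
  exact (hwu x) ▸ h2

namespace IsPointMap

variable {T : CompactlySupportedCk k d M ≃* CompactlySupportedCk k d M} {u : M ≃ₜ M}

theorem eventuallyEq (h : IsPointMap T u) {f g : CompactlySupportedCk k d M} {x : M}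
    (hfg : f.1 =ᶠ[𝓝 x] g.1) : (T f).1 =ᶠ[𝓝 (u x)] (T g).1 := by
  obtain ⟨e, he, hU⟩ := exists_bump (k := k) (d := d) hfg
  have : f * e = g * e := ext_apply fun z => by
    by_cases hz : e.1 z = 0
    · simp [hz]
    · have : f.1 z = g.1 z := hU (subset_tsupport e.1 hz)
      simp [this]
  have h2 := congrArg T this
  simp only [map_mul] at h2
  filter_upwards [(h e x).1 he] with z hz
  have := congrArg (fun g => g.1 z) h2
  simpa [hz] using this

theorem apply_eq_mul (h : IsPointMap T u) {f g g' : CompactlySupportedCk k d M} {x : M}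
    (hf : f.1 =ᶠ[𝓝 x] fun y => g.1 y * g'.1 y) :
    (T f).1 (u x) = (T g).1 (u x) * (T g').1 (u x) := by
  have := (h.eventuallyEq (g := g * g') hf).self_of_nhds
  rwa [map_mul] at this

theorem apply_eq_pow (h : IsPointMap T u) (g : CompactlySupportedCk k d M) {x : M} (m : ℕ) :
    ∀ {f : CompactlySupportedCk k d M}, (f.1 =ᶠ[𝓝 x] fun y => g.1 y ^ m) →
    (T f).1 (u x) = (T g).1 (u x) ^ m := by
  induction m with
  | zero =>
    intro f hf
    rw [pow_zero]
    exact h.apply_eq_one (hf.trans (by simp; rfl))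
  | succ m ih =>
    intro f hf
    obtain ⟨g', hg'⟩ := exists_eventuallyEq_pow g x m
    rw [h.apply_eq_mul (g := g') (g' := g), ih hg', pow_succ]
    filter_upwards [hf, hg'] with z h1 h2
    rw [h1, h2, pow_succ]

theorem apply_ne_zero (h : IsPointMap T u) {f : CompactlySupportedCk k d M} {x : M}
    (hf : f.1 x ≠ 0) : (T f).1 (u x) ≠ 0 := by
  obtain ⟨g, hg⟩ := exists_mul_eventuallyEq_one f hf
  have h1 := h.apply_eq_one hg
  rw [map_mul, mul_apply] at h1
  exact left_ne_zero_of_mul_eq_one h1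

theorem apply_eq_zero (h : IsPointMap T u) {f : CompactlySupportedCk k d M} {x : M}
    (hf : f.1 x = 0) : (T f).1 (u x) = 0 := by
  by_contra h0
  have := h.symm.apply_ne_zero h0
  simp [hf] at this

/-- A positive germ is a square, a property visible to multiplication. -/
theorem apply_pos (h : IsPointMap T u) {f : CompactlySupportedCk k d M} {x : M}
    (hf : 0 < f.1 x) : 0 < (T f).1 (u x) := by
  obtain ⟨g, hg⟩ := exists_mul_self_eventuallyEq f hf
  have h1 := h.apply_eq_mul hg
  rw [h1]
  exact mul_self_pos.2 fun h0 => h.apply_ne_zero hf.ne' (by rw [h1, h0, zero_mul])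

end IsPointMap

end PointMap

/-! ### Gluing rescaled exponentials into one function -/

section Series

variable {E : Type*} [NormedAddCommGroup E] [NormedSpace ℝ E]

theorem exists_norm_iteratedFDeriv_le {F : Type*} [NormedAddCommGroup F] [NormedSpace ℝ F]
    {N : ℕ∞} {f : E → F} (hf : ContDiff ℝ N f) (hc : HasCompactSupport f) (j : ℕ)
    (hj : (j : ℕ∞) ≤ N) :
    ∃ A, 1 ≤ A ∧ ∀ i ≤ j, ∀ x, ‖iteratedFDeriv ℝ i f x‖ ≤ A := by
  induction j with
  | zero =>
    obtain ⟨C, hC⟩ := (hf.continuous_iteratedFDeriv (m := 0) (mod_cast hj)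
      ).bounded_above_of_compact_support (hc.iteratedFDeriv 0)
    refine ⟨max 1 C, le_max_left _ _, fun i hi x => ?_⟩
    obtain rfl : i = 0 := by omega
    exact (hC x).trans (le_max_right _ _)
  | succ j ih =>
    obtain ⟨A, hA, hA'⟩ := ih (le_trans (mod_cast Nat.le_succ j) hj)
    obtain ⟨C, hC⟩ := (hf.continuous_iteratedFDeriv (m := j + 1) (mod_cast hj)
      ).bounded_above_of_compact_support (hc.iteratedFDeriv (j + 1))
    refine ⟨max A C, hA.trans (le_max_left _ _), fun i hi x => ?_⟩
    rcases Nat.lt_or_ge j i with h | h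
    · obtain rfl : i = j + 1 := by omega
      exact (hC x).trans (le_max_right _ _)
    · exact (hA' i h x).trans (le_max_left _ _)

theorem norm_iteratedFDeriv_smul_sub_le (r : ℝ) (a x : E) {i : ℕ} (hi : 1 ≤ i) :
    ‖iteratedFDeriv ℝ i (fun x => r • (x - a)) x‖ ≤ |r| := by
  obtain ⟨i, rfl⟩ := Nat.exists_eq_add_of_le' hi
  have hd : fderiv ℝ (fun x : E => r • (x - a)) = fun _ => r • ContinuousLinearMap.id ℝ E := by
    funext y
    exact (((hasFDerivAt_id y).sub_const a).const_smul r).fderiv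
  rw [← norm_iteratedFDeriv_fderiv, hd]
  cases i with
  | zero =>
    rw [norm_iteratedFDeriv_zero, norm_smul, Real.norm_eq_abs]
    exact mul_le_of_le_one_right (abs_nonneg r) ContinuousLinearMap.norm_id_le
  | succ i =>
    rw [iteratedFDeriv_succ_const]
    simp

theorem summable_half_pow_sq_mul_pow (j : ℕ) :
    Summable fun n : ℕ => (1 / 2 : ℝ) ^ ((n + 1) ^ 2) * ((32 : ℝ) ^ n) ^ j := by
  refine Summable.of_norm_bounded_eventually_nat summable_geometric_two ?_
  filter_upwards [eventually_ge_atTop (5 * j + 1)] with n hn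
  have h1 : n + 5 * (n * j) ≤ (n + 1) ^ 2 := by nlinarith
  have h2 : ((32 : ℝ) ^ n) ^ j = 2 ^ (5 * (n * j)) := by
    rw [pow_mul, pow_mul]
    norm_num
  rw [Real.norm_of_nonneg (by positivity), h2]
  calc (1 / 2 : ℝ) ^ ((n + 1) ^ 2) * 2 ^ (5 * (n * j))
      ≤ (1 / 2 : ℝ) ^ (n + 5 * (n * j)) * 2 ^ (5 * (n * j)) := by
        gcongr ?_ * _
        exact pow_le_pow_of_le_one (by norm_num) (by norm_num) h1
    _ = (1 / 2 : ℝ) ^ n := by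
        rw [pow_add, mul_assoc, ← mul_pow]
        norm_num

theorem add_one_pow_four_le (n : ℕ) : ((n : ℝ) + 1) ^ 4 ≤ 16 ^ n := by
  have h : (n : ℝ) + 1 ≤ 2 ^ n := by exact_mod_cast Nat.lt_two_pow_self
  calc ((n : ℝ) + 1) ^ 4 ≤ (2 ^ n) ^ 4 := by gcongr
    _ = 16 ^ n := by rw [← pow_mul, mul_comm, pow_mul]; norm_num

/-- The inner maps have derivatives of orders `1` to `j` bounded by `A * 32^n`, which covers both
the scaling `2^n` and `(n+1)^4 ≤ 16^n`. The composite then costs at most `j! * C * (A * 32^n)^j`,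
and the Gaussian decay of `c n` beats this for each fixed `j`. -/
theorem contDiff_tsum_rescaled {N : ℕ∞} {G : E × ℝ → ℝ} (hG : ContDiff ℝ N G)
    (hGc : HasCompactSupport G) {ψ : E → ℝ} (hψ : ContDiff ℝ N ψ) (hψc : HasCompactSupport ψ)
    (a : E) {c : ℕ → ℝ} (hc : ∀ n, |c n| ≤ (1 / 2) ^ ((n + 1) ^ 2)) :
    ContDiff ℝ N fun x => ∑' n : ℕ,
      c n * G ((2 : ℝ) ^ n • (x - a), ((n : ℝ) + 1) ^ 4 * ψ x) := by
  have hin₁ : ∀ n : ℕ, ContDiff ℝ N fun x : E => (2 : ℝ) ^ n • (x - a) := fun n =>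
    contDiff_const.smul (contDiff_id.sub contDiff_const)
  have hin₂ : ∀ n : ℕ, ContDiff ℝ N fun x : E => ((n : ℝ) + 1) ^ 4 * ψ x := fun n =>
    contDiff_const.mul hψ
  have hin : ∀ n : ℕ, ContDiff ℝ N
      fun x => ((2 : ℝ) ^ n • (x - a), ((n : ℝ) + 1) ^ 4 * ψ x) := fun n =>
    (hin₁ n).prodMk (hin₂ n)
  have hbound : ∀ j : ℕ, ∃ B : ℝ, (j : ℕ∞) ≤ N → ∀ (n : ℕ) (x : E),
      ‖iteratedFDeriv ℝ j
        (fun x => c n * G ((2 : ℝ) ^ n • (x - a), ((n : ℝ) + 1) ^ 4 * ψ x)) x‖ ≤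
      B * ((1 / 2 : ℝ) ^ ((n + 1) ^ 2) * ((32 : ℝ) ^ n) ^ j) := by
    intro j
    by_cases hj : (j : ℕ∞) ≤ N
    swap
    · exact ⟨0, fun h => absurd h hj⟩
    obtain ⟨C, hC1, hC⟩ := exists_norm_iteratedFDeriv_le hG hGc j hj
    obtain ⟨A, hA1, hA⟩ := exists_norm_iteratedFDeriv_le hψ hψc j hj
    refine ⟨j.factorial * C * A ^ j, fun _ n x => ?_⟩
    have hn4 : (1 : ℝ) ≤ ((n : ℝ) + 1) ^ 4 := one_le_pow₀ (by linarith [n.cast_nonneg (α := ℝ)])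
    have h32 : (1 : ℝ) ≤ 32 ^ n := one_le_pow₀ (by norm_num)
    have hcomp := norm_iteratedFDeriv_comp_le hG (hin n) (mod_cast hj : (j : ℕ∞ω) ≤ N) x
      (C := C) (D := A * 32 ^ n) (fun i hi => hC i hi _) (by
        intro i hi hij
        have hiN : (i : ℕ∞) ≤ N := le_trans (mod_cast hij) hj
        have hi1 : A * 32 ^ n ≤ (A * 32 ^ n) ^ i :=
          le_self_pow₀ (one_le_mul_of_one_le_of_one_le hA1 h32) (by omega)
        refine le_trans ?_ hi1
        rw [iteratedFDeriv_prodMk (n := N) (hin₁ n).contDiffAt (hin₂ n).contDiffAt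
          (mod_cast hiN), ContinuousMultilinearMap.opNorm_prod]
        refine max_le ((norm_iteratedFDeriv_smul_sub_le _ a x hi).trans ?_) ?_
        · rw [abs_of_nonneg (by positivity)]
          calc (2 : ℝ) ^ n ≤ 32 ^ n := by gcongr; norm_num
            _ ≤ A * 32 ^ n := le_mul_of_one_le_left (by positivity) hA1
        · have : (fun x => ((n : ℝ) + 1) ^ 4 * ψ x) = (((n : ℝ) + 1) ^ 4) • ψ := rfl
          rw [this, iteratedFDeriv_const_smul_apply
            (hψ.contDiffAt.of_le (mod_cast hiN)), norm_smul, Real.norm_of_nonneg (by positivity),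
            mul_comm]
          gcongr
          · exact hA i hij x
          · exact (add_one_pow_four_le n).trans (by gcongr; norm_num))
    have : (fun x => c n * G ((2 : ℝ) ^ n • (x - a), ((n : ℝ) + 1) ^ 4 * ψ x)) =
        c n • (G ∘ fun x => ((2 : ℝ) ^ n • (x - a), ((n : ℝ) + 1) ^ 4 * ψ x)) := rfl
    rw [this, iteratedFDeriv_const_smul_apply
      ((hG.comp (hin n)).contDiffAt.of_le (mod_cast hj)), norm_smul, Real.norm_eq_abs]
    calc _ ≤ (1 / 2 : ℝ) ^ ((n + 1) ^ 2) * (j.factorial * C * (A * 32 ^ n) ^ j) := by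
          gcongr
          exact hc n
      _ = _ := by rw [mul_pow]; ring
  choose B hB using hbound
  exact contDiff_tsum (v := fun j n => B j * ((1 / 2 : ℝ) ^ ((n + 1) ^ 2) * ((32 : ℝ) ^ n) ^ j))
    (fun n => contDiff_const.mul (hG.comp (hin n)))
    (fun j _ => (summable_half_pow_sq_mul_pow j).mul_left _) fun j n x hj => hB j hj n x

theorem exists_add_one_pow_four_le : ∃ K : ℝ, ∀ n : ℕ, ((n : ℝ) + 1) ^ 4 ≤ K * 2 ^ n := by
  obtain ⟨K, hK⟩ := (tendsto_pow_const_div_const_pow_of_one_lt 4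
    (one_lt_two : (1 : ℝ) < 2)).bddAbove_range
  refine ⟨2 * K, fun n => ?_⟩
  have := hK ⟨n + 1, rfl⟩
  simp only [Nat.cast_add, Nat.cast_one] at this
  rw [div_le_iff₀ (by positivity), pow_succ (2 : ℝ)] at this
  linarith

/-- Since `ψ` is Lipschitz and vanishes at `a`, it is `O(2^(-n))` at distance about `2^(-n)` from
`a`. So `(n+1)^4 * ψ` stays bounded there uniformly in `n`, and one cutoff of the exponential serves
all terms. -/
theorem exists_contDiff_eventuallyEq_exp [FiniteDimensional ℝ E] {N : ℕ∞} (hN : 1 ≤ N)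
    {ψ : E → ℝ} (hψ : ContDiff ℝ N ψ) (hψc : HasCompactSupport ψ) {a v : E} (hv : ‖v‖ = 1)
    (ha : ψ a = 0) {c : ℕ → ℝ} (hc : ∀ n, |c n| ≤ (1 / 2) ^ ((n + 1) ^ 2)) :
    ∃ H : E → ℝ, ContDiff ℝ N H ∧ ∀ n : ℕ, H =ᶠ[𝓝 (a + (1 / 2 : ℝ) ^ n • v)]
      fun x => c n * Real.exp (((n : ℝ) + 1) ^ 4 * ψ x) := by
  obtain ⟨L, hL⟩ := hψ.lipschitzWith_of_hasCompactSupport hψc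
    (by simpa using (zero_lt_one.trans_le hN).ne')
  obtain ⟨K, hK⟩ := exists_add_one_pow_four_le
  have hK0 : 0 < K := by
    have := hK 0
    norm_num at this
    linarith
  -- The factor 2 bounds `2^n * ‖x - a‖ < 9/8`; the added 1 keeps `C` positive when `L = 0`.
  let C : ℝ := K * (2 * L) + 1
  have hC : 0 < C := by positivity
  -- Where `2^n • (x - a)` is within `1/8` of the unit vector `v`, any other scale gives a vector of
  -- norm below `9/16` or above `7/4`, hence farther than `1/4` from `v`: only the `n`-th term
  -- survives.
  let b : ContDiffBump v := ⟨1 / 8, 1 / 4, by norm_num, by norm_num⟩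
  let χ : ContDiffBump (0 : ℝ) := ⟨C, C + 1, hC, by linarith⟩
  let G : E × ℝ → ℝ := fun p => b p.1 * (Real.exp p.2 * χ p.2)
  have hG : ContDiff ℝ N G := (b.contDiff.comp contDiff_fst).mul
    ((Real.contDiff_exp.comp contDiff_snd).mul (χ.contDiff.comp contDiff_snd))
  have hGc : HasCompactSupport G := by
    refine HasCompactSupport.intro
      ((isCompact_closedBall v b.rOut).prod (isCompact_closedBall (0 : ℝ) χ.rOut)) ?_
    rintro ⟨z, t⟩ hzt
    rw [mem_prod, not_and_or] at hzt
    rcases hzt with h | h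
    · simp [G, b.zero_of_le_dist (not_le.1 h).le]
    · simp [G, χ.zero_of_le_dist (not_le.1 h).le]
  refine ⟨_, contDiff_tsum_rescaled hG hGc hψ hψc a hc, fun n => ?_⟩
  filter_upwards [Metric.ball_mem_nhds (a + (1 / 2 : ℝ) ^ n • v)
    (ε := (1 / 2) ^ n * (1 / 8)) (by positivity)] with x hx
  have h2n : (2 : ℝ) ^ n * (1 / 2) ^ n = 1 := by rw [← mul_pow]; norm_num
  have hpos : (0 : ℝ) < 2 ^ n := by positivity
  have hdist : ‖(2 : ℝ) ^ n • (x - a) - v‖ < 1 / 8 := by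
    have h1 : (2 : ℝ) ^ n • (x - a) - v = (2 : ℝ) ^ n • (x - (a + (1 / 2 : ℝ) ^ n • v)) := by
      rw [← sub_sub, smul_sub _ (x - a), smul_smul, h2n, one_smul]
    rw [mem_ball_iff_norm] at hx
    rw [h1, norm_smul, Real.norm_of_nonneg hpos.le]
    calc _ < (2 : ℝ) ^ n * ((1 / 2) ^ n * (1 / 8)) := by gcongr
      _ = 1 / 8 := by rw [← mul_assoc, h2n, one_mul]
  have hupper : 2 ^ n * ‖x - a‖ < 9 / 8 := by
    have := norm_le_norm_add_norm_sub' ((2 : ℝ) ^ n • (x - a)) v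
    rw [norm_smul, Real.norm_of_nonneg hpos.le, hv] at this
    linarith
  have hlower : 7 / 8 < 2 ^ n * ‖x - a‖ := by
    have := norm_le_norm_add_norm_sub ((2 : ℝ) ^ n • (x - a)) v
    rw [norm_smul, Real.norm_of_nonneg hpos.le, hv] at this
    linarith
  rw [tsum_eq_single n]
  · have hb : b ((2 : ℝ) ^ n • (x - a)) = 1 :=
      b.one_of_mem_closedBall (mem_closedBall_iff_norm.2 hdist.le)
    have hχ : χ (((n : ℝ) + 1) ^ 4 * ψ x) = 1 := by
      refine χ.one_of_mem_closedBall (mem_closedBall_zero_iff.2 ?_)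
      rw [norm_mul, Real.norm_of_nonneg (by positivity)]
      have h3 : ‖ψ x‖ ≤ L * ‖x - a‖ := by simpa [ha] using hL.norm_sub_le x a
      calc _ ≤ (K * 2 ^ n) * (L * ‖x - a‖) := by
            gcongr
            exact hK n
        _ = K * L * (2 ^ n * ‖x - a‖) := by ring
        _ ≤ K * L * 2 := by gcongr; linarith
        _ ≤ C := by simp only [C]; linarith
    simp [G, hb, hχ]
  · intro m hm
    have hb : b ((2 : ℝ) ^ m • (x - a)) = 0 := by
      refine b.zero_of_le_dist ?_
      rw [dist_eq_norm]
      have hm2 : ‖(2 : ℝ) ^ m • (x - a)‖ = 2 ^ m * ‖x - a‖ := by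
        rw [norm_smul, Real.norm_of_nonneg (by positivity)]
      change (1 / 4 : ℝ) ≤ _
      rcases lt_or_gt_of_ne hm with h | h
      · have h4 : (2 : ℝ) ^ m * 2 ≤ 2 ^ n := by
          rw [← pow_succ]
          exact pow_le_pow_right₀ (by norm_num) h
        have := norm_le_norm_add_norm_sub ((2 : ℝ) ^ m • (x - a)) v
        rw [hm2, hv] at this
        nlinarith [mul_le_mul_of_nonneg_right h4 (norm_nonneg (x - a))]
      · have h4 : (2 : ℝ) ^ n * 2 ≤ 2 ^ m := by
          rw [← pow_succ]
          exact pow_le_pow_right₀ (by norm_num) h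
        have := norm_le_norm_add_norm_sub' ((2 : ℝ) ^ m • (x - a)) v
        rw [hm2, hv] at this
        nlinarith [mul_le_mul_of_nonneg_right h4 (norm_nonneg (x - a))]
    simp [G, hb]

end Series

/-! ### Dependence on values rather than germs -/

section Values

variable {k : ℕ∞} {d : ℕ} {M : Type*} [TopologicalSpace M]
  [ChartedSpace (EuclideanSpace ℝ (Fin d)) M] [T2Space M] [IsManifold (𝓡 d) k M]

open CompactlySupportedCk

/-- Along a suitable sequence converging to `x₀`, one may prescribe the germs to be
rapidly decreasing multiples of polynomially growing powers of a function equal to `1` at `x₀`. -/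
theorem CompactlySupportedCk.exists_seq_eventuallyEq (hk : 1 ≤ k) (hd : 1 ≤ d) (x₀ : M) :
    ∃ xs : ℕ → M, Tendsto xs atTop (𝓝 x₀) ∧
      ∀ f : CompactlySupportedCk k d M, f.1 x₀ = 1 →
      ∀ c : ℕ → ℝ, (∀ n, |c n| ≤ (1 / 2) ^ ((n + 1) ^ 2)) →
      ∃ H : CompactlySupportedCk k d M, ∀ᶠ n : ℕ in atTop,
        H.1 =ᶠ[𝓝 (xs n)] fun y => c n * f.1 y ^ ((n + 1) ^ 4) := by
  let E := EuclideanSpace ℝ (Fin d)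
  let φ := chartAt E x₀
  have hx₀ : x₀ ∈ φ.source := mem_chart_source E x₀
  let v : E := EuclideanSpace.single (⟨0, hd⟩ : Fin d) (1 : ℝ)
  have hv : ‖v‖ = 1 := (PiLp.norm_single 2 (fun _ => ℝ) _ _).trans norm_one
  let ys : ℕ → E := fun n => φ x₀ + (1 / 2 : ℝ) ^ n • v
  have hys : Tendsto ys atTop (𝓝 (φ x₀)) := by
    have h1 : Tendsto (fun n : ℕ => (1 / 2 : ℝ) ^ n) atTop (𝓝 0) :=
      tendsto_pow_atTop_nhds_zero_of_lt_one (by norm_num) (by norm_num)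
    simpa [ys] using (h1.smul_const v).const_add (φ x₀)
  have hxs : Tendsto (fun n => φ.symm (ys n)) atTop (𝓝 x₀) := by
    have h1 := (φ.continuousAt_symm (φ.map_source hx₀)).tendsto
    rw [φ.left_inv hx₀] at h1
    exact h1.comp hys
  refine ⟨_, hxs, fun f hf c hc => ?_⟩
  have hf0 : 0 < f.1 x₀ := hf ▸ one_pos
  -- In the chart `f` becomes `exp ψ`, so its powers are exponentials of multiples of `ψ`, and `f x₀
  -- = 1` becomes `ψ = 0` at the centre.
  obtain ⟨l, hl⟩ := exists_eventuallyEq_comp f isOpen_compl_singleton hf0.ne'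
    (θ := Real.log) Real.contDiffOn_log
  obtain ⟨ψ, hψ⟩ := exists_eventuallyEq (k := k) (d := d)
    (φ.open_target.mem_nhds (φ.map_source hx₀))
    ((contMDiff_coe l).comp_contMDiffOn (contMDiffOn_chart_symm (I := 𝓡 d) (x := x₀)))
  have hψ0 : ψ.1 (φ x₀) = 0 := by
    rw [hψ.self_of_nhds]
    simp only [Function.comp_apply]
    rw [φ.left_inv hx₀, hl.self_of_nhds]
    simp [hf]
  obtain ⟨H₀, hH₀, hH₀'⟩ := exists_contDiff_eventuallyEq_exp hk (contMDiff_coe ψ).contDiff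
    (hasCompactSupport_coe ψ) hv hψ0 hc
  obtain ⟨H, hH⟩ := exists_eventuallyEq (k := k) (d := d)
    (φ.open_source.mem_nhds hx₀)
    (hH₀.contMDiff.comp_contMDiffOn (contMDiffOn_chart (I := 𝓡 d) (x := x₀)))
  refine ⟨H, ?_⟩
  have hnear : ∀ᶠ z in 𝓝 x₀, H.1 z = H₀ (φ z) ∧ f.1 z = Real.exp (ψ.1 (φ z)) := by
    filter_upwards [hH, hl, (φ.continuousAt hx₀).eventually hψ, φ.open_source.mem_nhds hx₀,
      (continuous_coe f).continuousAt.eventually_const_lt hf0] with z h1 h2 h3 h4 h5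
    refine ⟨h1, ?_⟩
    rw [h3, Function.comp_apply, φ.left_inv h4, h2, Real.exp_log h5]
  filter_upwards [hxs.eventually (eventually_eventually_nhds.2 hnear),
    hxs.eventually (φ.open_source.mem_nhds hx₀),
    hys.eventually (φ.open_target.mem_nhds (φ.map_source hx₀))] with n h1 h2 h3
  have h4 := hH₀' n
  have h5 : φ (φ.symm (ys n)) = ys n := φ.right_inv h3
  have h6 : Tendsto φ (𝓝 (φ.symm (ys n))) (𝓝 (ys n)) := by
    have := (φ.continuousAt h2).tendsto
    rwa [h5] at this
  filter_upwards [h1, h6.eventually h4] with z h7 h8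
  rw [h7.1, h8, h7.2, ← Real.exp_nat_mul]
  push_cast
  rfl

namespace IsPointMap

variable {T : CompactlySupportedCk k d M ≃* CompactlySupportedCk k d M} {u : M ≃ₜ M}

theorem apply_le_one (hk : 1 ≤ k) (hd : 1 ≤ d) (h : IsPointMap T u)
    {f : CompactlySupportedCk k d M} {x : M} (hf : f.1 x = 1) : (T f).1 (u x) ≤ 1 := by
  by_contra! hlt
  obtain ⟨xs, hxs, hH⟩ := exists_seq_eventuallyEq (k := k) (d := d) hk hd x
  obtain ⟨H, hH⟩ := hH f hf (fun n => (1 / 2) ^ ((n + 1) ^ 2)) fun n =>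
    (abs_of_pos (by positivity)).le
  -- The image of the scalar `1/2` is unknown but positive at `u x`; this `g` lets `T` be evaluated
  -- on its powers.
  obtain ⟨g, hg⟩ := exists_eventuallyEq_const (k := k) (d := d) x (1 / 2)
  have hg0 : 0 < (T g).1 (u x) := h.apply_pos (by rw [hg.self_of_nhds]; norm_num)
  have hux : Tendsto (fun n => u (xs n)) atTop (𝓝 (u x)) := (u.continuous.tendsto x).comp hxs
  have hval : ∀ᶠ n : ℕ in atTop, (T H).1 (u (xs n)) =
      (T g).1 (u (xs n)) ^ ((n + 1) ^ 2) * (T f).1 (u (xs n)) ^ ((n + 1) ^ 4) := by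
    filter_upwards [hH, hxs.eventually (eventually_eventually_nhds.2 hg)] with n h1 h2
    obtain ⟨g', hg'⟩ := exists_eventuallyEq_pow g (xs n) ((n + 1) ^ 2)
    obtain ⟨f', hf'⟩ := exists_eventuallyEq_pow f (xs n) ((n + 1) ^ 4)
    rw [← h.apply_eq_pow g _ hg', ← h.apply_eq_pow f _ hf']
    refine h.apply_eq_mul ?_
    filter_upwards [h1, h2, hg', hf'] with z h3 h4 h5 h6
    rw [h3, h5, h6, h4]
  obtain ⟨q, hq0, hq⟩ := exists_between hg0
  obtain ⟨r, hr1, hr⟩ := exists_between hlt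
  -- As `(n+1)^4` is the square of `(n+1)^2`, the product is at least `(q * r^((n+1)^2))^((n+1)^2)`,
  -- whose base eventually exceeds 2 however small `q > 0` is.
  have hgt : ∀ᶠ n : ℕ in atTop, (2 : ℝ) ^ ((n + 1) ^ 2) ≤ (T H).1 (u (xs n)) := by
    have h1 : Tendsto (fun n : ℕ => q * r ^ ((n + 1) ^ 2)) atTop atTop :=
      ((tendsto_pow_atTop_atTop_of_one_lt hr1).comp
        ((tendsto_pow_atTop two_ne_zero).comp (tendsto_add_atTop_nat 1))).const_mul_atTop hq0
    filter_upwards [hval, h1.eventually_ge_atTop 2,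
      hux.eventually ((continuous_coe (T g)).continuousAt.eventually_const_lt hq),
      hux.eventually ((continuous_coe (T f)).continuousAt.eventually_const_lt hr)]
      with n h2 h3 h4 h5
    rw [h2]
    have hr0 : 0 < r := one_pos.trans hr1
    have hg1 : 0 < (T g).1 (u (xs n)) := hq0.trans h4
    calc (2 : ℝ) ^ ((n + 1) ^ 2) ≤ (q * r ^ ((n + 1) ^ 2)) ^ ((n + 1) ^ 2) := by gcongr
      _ = q ^ ((n + 1) ^ 2) * r ^ ((n + 1) ^ 4) := by
        rw [mul_pow, ← pow_mul]
        ring_nf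
      _ ≤ _ := by gcongr
  have h1 : Tendsto (fun n : ℕ => (2 : ℝ) ^ ((n + 1) ^ 2)) atTop atTop :=
    (tendsto_pow_atTop_atTop_of_one_lt one_lt_two).comp
      ((tendsto_pow_atTop two_ne_zero).comp (tendsto_add_atTop_nat 1))
  exact not_tendsto_nhds_of_tendsto_atTop (tendsto_atTop_mono' _ hgt h1) _
    (((continuous_coe (T H)).tendsto _).comp hux)

/-- The upper bound also applies to a local inverse of `f`, and the two images multiply to 1. -/
theorem apply_eq_one_of_apply_eq_one (hk : 1 ≤ k) (hd : 1 ≤ d) (h : IsPointMap T u)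
    {f : CompactlySupportedCk k d M} {x : M} (hf : f.1 x = 1) : (T f).1 (u x) = 1 := by
  obtain ⟨g, hg⟩ := exists_mul_eventuallyEq_one f (hf ▸ one_ne_zero)
  have hg1 : g.1 x = 1 := by simpa [hf] using hg.self_of_nhds
  have h1 := h.apply_eq_one hg
  rw [map_mul, mul_apply] at h1
  have h2 := h.apply_le_one hk hd hf
  have h3 := h.apply_le_one hk hd hg1
  have h4 := h.apply_pos (hf ▸ one_pos)
  nlinarith

theorem apply_congr (hk : 1 ≤ k) (hd : 1 ≤ d) (h : IsPointMap T u)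
    {f g : CompactlySupportedCk k d M} {x : M} (hfg : f.1 x = g.1 x) :
    (T f).1 (u x) = (T g).1 (u x) := by
  by_cases h0 : f.1 x = 0
  · rw [h.apply_eq_zero h0, h.apply_eq_zero (hfg ▸ h0)]
  · obtain ⟨f', hf'⟩ := exists_mul_eventuallyEq_one f h0
    have hf1 : (f * f').1 x = 1 := hf'.self_of_nhds
    have hg1 : (g * f').1 x = 1 := by rw [mul_apply, ← hfg, ← mul_apply, hf1]
    have h1 := h.apply_eq_one_of_apply_eq_one hk hd hf1
    have h2 := h.apply_eq_one_of_apply_eq_one hk hd hg1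
    rw [map_mul, mul_apply] at h1 h2
    exact mul_right_cancel₀ (right_ne_zero_of_mul_eq_one h1) (h1.trans h2.symm)

end IsPointMap

end Values

/-! ### Power maps on the fibres, smoothness of the point map, exponent one -/

section Rigidity

variable {k : ℕ∞} {d : ℕ} {M : Type*} [TopologicalSpace M]
  [ChartedSpace (EuclideanSpace ℝ (Fin d)) M] [T2Space M] [IsManifold (𝓡 d) k M]

open CompactlySupportedCk

/-- The value at `u x` of the image under `T` of a function equal to `c` near `x`. -/
noncomputable def germValue (T : CompactlySupportedCk k d M ≃* CompactlySupportedCk k d M)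
    (u : M ≃ₜ M) (x : M) (c : ℝ) : ℝ :=
  (T (exists_eventuallyEq_const (k := k) (d := d) x c).choose).1 (u x)

/-- The exponent of the multiplicative map `germValue T u x`. -/
noncomputable def germExponent (T : CompactlySupportedCk k d M ≃* CompactlySupportedCk k d M)
    (u : M ≃ₜ M) (x : M) : ℝ :=
  Real.log (germValue T u x (Real.exp 1))

namespace IsPointMap

variable {T : CompactlySupportedCk k d M ≃* CompactlySupportedCk k d M} {u : M ≃ₜ M}

theorem apply_eq_germValue (hk : 1 ≤ k) (hd : 1 ≤ d) (h : IsPointMap T u)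
    (f : CompactlySupportedCk k d M) (x : M) : (T f).1 (u x) = germValue T u x (f.1 x) :=
  h.apply_congr hk hd (exists_eventuallyEq_const (k := k) (d := d) x (f.1 x)
    ).choose_spec.self_of_nhds.symm

theorem germValue_mul (hk : 1 ≤ k) (hd : 1 ≤ d) (h : IsPointMap T u) (x : M) (a b : ℝ) :
    germValue T u x (a * b) = germValue T u x a * germValue T u x b := by
  obtain ⟨f, hf⟩ := exists_eventuallyEq_const (k := k) (d := d) x a
  obtain ⟨g, hg⟩ := exists_eventuallyEq_const (k := k) (d := d) x b
  have h1 := h.apply_eq_germValue hk hd (f * g) x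
  rw [map_mul, mul_apply, mul_apply, h.apply_eq_germValue hk hd, h.apply_eq_germValue hk hd,
    hf.self_of_nhds, hg.self_of_nhds] at h1
  exact h1.symm

theorem germValue_zero (h : IsPointMap T u) (x : M) : germValue T u x 0 = 0 :=
  h.apply_eq_zero (exists_eventuallyEq_const (k := k) (d := d) x 0).choose_spec.self_of_nhds

theorem germValue_one (h : IsPointMap T u) (x : M) : germValue T u x 1 = 1 :=
  h.apply_eq_one (exists_eventuallyEq_const (k := k) (d := d) x 1).choose_spec

theorem germValue_pos (h : IsPointMap T u) (x : M) {c : ℝ} (hc : 0 < c) :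
    0 < germValue T u x c :=
  h.apply_pos
    ((exists_eventuallyEq_const (k := k) (d := d) x c).choose_spec.self_of_nhds.symm ▸ hc)

theorem germValue_pow (hk : 1 ≤ k) (hd : 1 ≤ d) (h : IsPointMap T u) (x : M) (c : ℝ) (m : ℕ) :
    germValue T u x (c ^ m) = germValue T u x c ^ m := by
  induction m with
  | zero => simp [h.germValue_one]
  | succ m ih => rw [pow_succ, h.germValue_mul hk hd, ih, pow_succ]

theorem germValue_symm_germValue (hk : 1 ≤ k) (hd : 1 ≤ d) (h : IsPointMap T u) (x : M) (c : ℝ) :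
    germValue T.symm u.symm (u x) (germValue T u x c) = c := by
  obtain ⟨f, hf⟩ := exists_eventuallyEq_const (k := k) (d := d) x c
  have h1 := h.apply_eq_germValue hk hd f x
  have h2 := h.symm.apply_eq_germValue hk hd (T f) (u x)
  rw [T.symm_apply_apply, u.symm_apply_apply, h1, hf.self_of_nhds] at h2
  exact h2.symm

theorem continuous_germValue (hk : 1 ≤ k) (hd : 1 ≤ d) (h : IsPointMap T u) (c : ℝ) :
    Continuous fun x => germValue T u x c := by
  refine continuous_iff_continuousAt.2 fun x => ?_
  obtain ⟨f, hf⟩ := exists_eventuallyEq_const (k := k) (d := d) x c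
  refine ((continuous_coe (T f)).comp u.continuous).continuousAt.congr ?_
  filter_upwards [hf] with z hz
  rw [Function.comp_apply, h.apply_eq_germValue hk hd, hz]

/-- Otherwise, glue the constants `c^(m n)`, with `m n` large enough for rapid decay, along `xs`.
The glued function vanishes at `x`, yet its image stays at least 1 along `u (xs n)`. -/
theorem germValue_le_one (hk : 1 ≤ k) (hd : 1 ≤ d) (h : IsPointMap T u) (x : M) {c : ℝ}
    (hc0 : 0 < c) (hc1 : c < 1) : germValue T u x c ≤ 1 := by
  by_contra! hlt
  obtain ⟨xs, hxs, hH⟩ := exists_seq_eventuallyEq (k := k) (d := d) hk hd x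
  obtain ⟨e, he, -⟩ := exists_bump (k := k) (d := d) (univ_mem (f := 𝓝 x))
  choose m hm using fun n : ℕ =>
    exists_pow_lt_of_lt_one (show (0 : ℝ) < (1 / 2) ^ ((n + 1) ^ 2) by positivity) hc1
  obtain ⟨H, hH⟩ := hH e he.self_of_nhds (fun n => c ^ m n) fun n => by
    rw [abs_of_pos (by positivity)]
    exact (hm n).le
  have hHxs : ∀ᶠ n in atTop, H.1 (xs n) = c ^ m n := by
    filter_upwards [hH, hxs.eventually he] with n h1 h2
    rw [h1.self_of_nhds]
    simp [h2]
  have hc0' : Tendsto (fun n => c ^ m n) atTop (𝓝 0) := by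
    refine squeeze_zero (fun n => by positivity) (fun n => (hm n).le) ?_
    exact (tendsto_pow_atTop_nhds_zero_of_lt_one (by norm_num) (by norm_num)).comp
      ((tendsto_pow_atTop two_ne_zero).comp (tendsto_add_atTop_nat 1))
  have hHx : H.1 x = 0 := tendsto_nhds_unique
    (((continuous_coe H).tendsto x).comp hxs) (hc0'.congr' (hHxs.mono fun n hn => hn.symm))
  have hTH : Tendsto (fun n => (T H).1 (u (xs n))) atTop (𝓝 0) := by
    rw [← h.apply_eq_zero hHx]
    exact (((continuous_coe (T H)).comp u.continuous).tendsto x).comp hxs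
  refine absurd (ge_of_tendsto hTH ?_) (not_le.2 (one_pos : (0 : ℝ) < 1))
  filter_upwards [hHxs, hxs.eventually
    ((h.continuous_germValue hk hd c).continuousAt.eventually_const_lt hlt)] with n h1 h2
  rw [h.apply_eq_germValue hk hd, h1, h.germValue_pow hk hd]
  exact one_le_pow₀ h2.le

/-- In logarithmic coordinates the map is additive and monotone, hence bounded near 0, continuous
and linear. -/
theorem germValue_exp (hk : 1 ≤ k) (hd : 1 ≤ d) (h : IsPointMap T u) (x : M) (t : ℝ) :
    germValue T u x (Real.exp t) = Real.exp (t * germExponent T u x) := by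
  have hpos : ∀ s, 0 < germValue T u x (Real.exp s) := fun s => h.germValue_pos x (Real.exp_pos s)
  let A : ℝ →+ ℝ := AddMonoidHom.mk' (fun s => Real.log (germValue T u x (Real.exp s)))
    fun a b => by
      rw [Real.exp_add, h.germValue_mul hk hd, Real.log_mul (hpos a).ne' (hpos b).ne']
  have hA : ∀ s, A s = Real.log (germValue T u x (Real.exp s)) := fun _ => rfl
  have hneg : ∀ s, 0 ≤ s → 0 ≤ A s := by
    intro s hs
    rcases hs.eq_or_lt with rfl | hs
    · simp
    · have h1 : A (-s) ≤ 0 := Real.log_nonpos (hpos _).le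
        (h.germValue_le_one hk hd x (Real.exp_pos _) (by simpa using hs))
      rw [map_neg] at h1
      linarith
  have hmono : ∀ s t, s ≤ t → A s ≤ A t := by
    intro s t hst
    have := hneg (t - s) (by linarith)
    rw [map_sub] at this
    linarith
  have hcont : Continuous A := by
    refine A.continuous_of_isBounded_nhds_zero (Metric.closedBall_mem_nhds 0 one_pos) ?_
    refine (Metric.isBounded_Icc (A (-1)) (A 1)).subset ?_
    rintro _ ⟨s, hs, rfl⟩
    rw [mem_closedBall_zero_iff, Real.norm_eq_abs, abs_le] at hs
    exact ⟨hmono _ _ hs.1, hmono _ _ hs.2⟩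
  have h1 := map_real_smul A hcont t 1
  rw [smul_eq_mul, mul_one, smul_eq_mul, hA, hA] at h1
  rw [germExponent, ← h1, Real.exp_log (hpos t)]

theorem germExponent_mul_germExponent_symm (hk : 1 ≤ k) (hd : 1 ≤ d) (h : IsPointMap T u)
    (x : M) : germExponent T u x * germExponent T.symm u.symm (u x) = 1 := by
  have h1 := h.germValue_symm_germValue hk hd x (Real.exp 1)
  rw [h.germValue_exp hk hd, h.symm.germValue_exp hk hd, Real.exp_eq_exp] at h1
  simpa using h1

theorem continuous_germExponent (hk : 1 ≤ k) (hd : 1 ≤ d) (h : IsPointMap T u) :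
    Continuous (germExponent T u) :=
  (h.continuous_germValue hk hd _).log fun x => (h.germValue_pos x (Real.exp_pos 1)).ne'

/-- With `g = exp f` and `e` the constant `exp 1` near the point, `log (T g) / log (T e)` equals `f
∘ u.symm`: the exponent, only known to be continuous, cancels. -/
theorem contMDiff_comp_symm (hk : 1 ≤ k) (hd : 1 ≤ d) (h : IsPointMap T u)
    (f : CompactlySupportedCk k d M) :
    ContMDiff (𝓡 d) 𝓘(ℝ, ℝ) k fun y => f.1 (u.symm y) := by
  intro y
  obtain ⟨g, hg⟩ := exists_eventuallyEq_comp f (x := u.symm y) isOpen_univ (mem_univ _)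
    Real.contDiff_exp.contDiffOn
  obtain ⟨e, he⟩ := exists_eventuallyEq_const (k := k) (d := d) (u.symm y) (Real.exp 1)
  have hval : ∀ (a : CompactlySupportedCk k d M) (t : ℝ) (z : M), a.1 (u.symm z) = Real.exp t →
      Real.log ((T a).1 z) = t * germExponent T u (u.symm z) := by
    intro a t z hz
    have := h.apply_eq_germValue hk hd a (u.symm z)
    rw [u.apply_symm_apply] at this
    rw [this, hz, h.germValue_exp hk hd, Real.log_exp]
  have hne : ∀ z, germExponent T u z ≠ 0 := fun z =>
    left_ne_zero_of_mul_eq_one (h.germExponent_mul_germExponent_symm hk hd z)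
  have hlog : ∀ (a : CompactlySupportedCk k d M), 0 < a.1 (u.symm y) →
      ContMDiffAt (𝓡 d) 𝓘(ℝ, ℝ) k (fun z => Real.log ((T a).1 z)) y := by
    intro a ha
    have := h.apply_pos ha
    rw [u.apply_symm_apply] at this
    exact (Real.contDiffAt_log.2 this.ne').contMDiffAt.comp y (contMDiff_coe (T a)).contMDiffAt
  have h1 := hlog g (by rw [hg.self_of_nhds]; exact Real.exp_pos _)
  have h2 := hlog e (by rw [he.self_of_nhds]; exact Real.exp_pos _)
  refine (h1.div₀ h2 ?_).congr_of_eventuallyEq ?_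
  · rw [hval e 1 y he.self_of_nhds, one_mul]
    exact hne _
  · filter_upwards [u.symm.continuous.continuousAt.eventually hg,
      u.symm.continuous.continuousAt.eventually he] with z h3 h4
    simp only [Pi.div_apply]
    rw [hval g _ z h3, hval e 1 z h4, one_mul, mul_div_cancel_right₀ _ (hne _)]

theorem contMDiff_symm (hk : 1 ≤ k) (hd : 1 ≤ d) (h : IsPointMap T u) :
    ContMDiff (𝓡 d) (𝓡 d) k u.symm := by
  intro y
  refine contMDiffAt_iff_target.2 ⟨u.symm.continuous.continuousAt, ?_⟩
  have hcoord : ∀ i : Fin d, ContMDiffAt (𝓡 d) 𝓘(ℝ, ℝ) k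
      (fun z => (extChartAt (𝓡 d) (u.symm y) (u.symm z)) i) y := by
    intro i
    obtain ⟨f, hf⟩ := exists_eventuallyEq (k := k) (d := d)
      ((chartAt (EuclideanSpace ℝ (Fin d)) (u.symm y)).open_source.mem_nhds
        (mem_chart_source _ (u.symm y)))
      ((EuclideanSpace.proj (𝕜 := ℝ) i).contDiff.contMDiff.comp_contMDiffOn
        (contMDiffOn_chart (I := 𝓡 d) (x := u.symm y)))
    exact (h.contMDiff_comp_symm hk hd f y).congr_of_eventuallyEq
      ((u.symm.continuous.continuousAt.eventually hf).mono fun z hz => hz.symm)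
  exact (EuclideanSpace.equiv (Fin d) ℝ).symm.contDiff.contMDiff.contMDiffAt.comp y
    (contMDiffAt_pi_space.2 hcoord)

/-- Along a coordinate line `γ`, a centred coordinate `f` takes the value `s`, so `T f ∘ u ∘ γ` is
`s^p` for small `s > 0`. It is differentiable at 0, hence `O(s)`, which rules out `p < 1`. -/
theorem one_le_germExponent (hk : 1 ≤ k) (hd : 1 ≤ d) (h : IsPointMap T u) (x : M) :
    1 ≤ germExponent T u x := by
  by_contra! hlt
  let E := EuclideanSpace ℝ (Fin d)
  let φ := chartAt E x
  have hx : x ∈ φ.source := mem_chart_source E x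
  let i₀ : Fin d := ⟨0, hd⟩
  let v : E := EuclideanSpace.single i₀ (1 : ℝ)
  obtain ⟨f, hf⟩ := exists_eventuallyEq (k := k) (d := d) (φ.open_source.mem_nhds hx)
    (((EuclideanSpace.proj (𝕜 := ℝ) i₀).contDiff.contMDiff.comp_contMDiffOn
      (contMDiffOn_chart (I := 𝓡 d) (x := x))).sub (contMDiffOn_const (c := φ x i₀)))
  let γ : ℝ → M := fun s => φ.symm (φ x + s • v)
  have hline : ContDiff ℝ k fun s : ℝ => φ x + s • v :=
    contDiff_const.add (contDiff_id.smul contDiff_const)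
  have hline0 : φ x + (0 : ℝ) • v = φ x := by simp
  have hγ0 : γ 0 = x := by simp [γ, φ.left_inv hx]
  have hγ : ContMDiffAt 𝓘(ℝ, ℝ) (𝓡 d) k γ 0 := by
    refine ContMDiffAt.comp (0 : ℝ) (I' := 𝓡 d) ?_ hline.contMDiff.contMDiffAt
    rw [hline0]
    exact (contMDiffOn_chart_symm (I := 𝓡 d) (x := x)).contMDiffAt
      (φ.open_target.mem_nhds (φ.map_source hx))
  let g : ℝ → ℝ := fun s => (T f).1 (u (γ s))
  have hg : DifferentiableAt ℝ g 0 := by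
    have h1 : ContMDiffAt 𝓘(ℝ, ℝ) 𝓘(ℝ, ℝ) k g 0 :=
      ((contMDiff_coe (T f)).comp (h.symm.contMDiff_symm hk hd)).contMDiffAt.comp (0 : ℝ) hγ
    exact h1.contDiffAt.differentiableAt (by simpa using (zero_lt_one.trans_le hk).ne')
  have hfγ : ∀ᶠ s in 𝓝 (0 : ℝ), f.1 (γ s) = s := by
    have h1 : Tendsto γ (𝓝 0) (𝓝 x) := by
      have := hγ.continuousAt.tendsto
      rwa [hγ0] at this
    have h2 : Tendsto (fun s : ℝ => φ x + s • v) (𝓝 0) (𝓝 (φ x)) := by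
      have := hline.continuous.tendsto 0
      rwa [hline0] at this
    filter_upwards [h1.eventually hf,
      h2.eventually (φ.open_target.mem_nhds (φ.map_source hx))] with s h3 h4
    have h5 : φ (γ s) = φ x + s • v := φ.right_inv h4
    rw [h3]
    change φ (γ s) i₀ - φ x i₀ = s
    rw [h5]
    have hsub : ∀ y : EuclideanSpace ℝ (Fin d),
        (y + s • EuclideanSpace.single i₀ (1 : ℝ)) i₀ - y i₀ = s := fun y => by simp
    exact hsub _
  have hg0 : g 0 = 0 := by
    have : f.1 (γ 0) = 0 := hfγ.self_of_nhds
    exact h.apply_eq_zero this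
  obtain ⟨C, hC⟩ := hg.isBigO_sub.bound
  obtain ⟨r, hr, hr1⟩ := exists_between hlt
  have hp : ∀ᶠ s in 𝓝 (0 : ℝ), germExponent T u (γ s) < r := by
    have h1 : ContinuousAt (fun s => germExponent T u (γ s)) 0 :=
      (h.continuous_germExponent hk hd).continuousAt.comp hγ.continuousAt
    exact h1.eventually_lt_const (show germExponent T u (γ 0) < r by rwa [hγ0])
  have hlim : Tendsto (fun s : ℝ => s ^ (r - 1)) (𝓝[>] 0) atTop :=
    tendsto_rpow_neg_nhdsGT_zero (by linarith)
  have hev : ∀ᶠ s in 𝓝[>] (0 : ℝ), False := by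
    filter_upwards [self_mem_nhdsWithin, nhdsWithin_le_nhds hC, nhdsWithin_le_nhds hfγ,
      nhdsWithin_le_nhds hp, nhdsWithin_le_nhds (Iio_mem_nhds one_pos),
      hlim.eventually_gt_atTop C] with s h0 h1 h2 h3 h4 h5
    have h0' : 0 < s := h0
    have hgs : g s = Real.exp (Real.log s * germExponent T u (γ s)) := by
      rw [← h.germValue_exp hk hd, Real.exp_log h0', ← h2, h2]
      exact (h.apply_eq_germValue hk hd f (γ s)).trans (by rw [h2])
    have hsr : s ^ r ≤ g s := by
      rw [hgs, Real.rpow_def_of_pos h0', Real.exp_le_exp]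
      exact mul_le_mul_of_nonpos_left h3.le (Real.log_nonpos h0'.le (le_of_lt h4))
    rw [hg0, sub_zero, sub_zero, Real.norm_of_nonneg h0'.le] at h1
    have h6 : s ^ r ≤ C * s := hsr.trans ((le_abs_self _).trans h1)
    rw [Real.rpow_sub_one h0'.ne', lt_div_iff₀ h0'] at h5
    linarith
  exact hev.exists.elim fun _ => id

theorem germExponent_eq_one (hk : 1 ≤ k) (hd : 1 ≤ d) (h : IsPointMap T u) (x : M) :
    germExponent T u x = 1 := by
  have h1 := h.one_le_germExponent hk hd x
  have h2 := h.symm.one_le_germExponent hk hd (u x)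
  have h3 := h.germExponent_mul_germExponent_symm hk hd x
  nlinarith

theorem germValue_of_pos (hk : 1 ≤ k) (hd : 1 ≤ d) (h : IsPointMap T u) (x : M) {c : ℝ}
    (hc : 0 < c) : germValue T u x c = c := by
  rw [← Real.exp_log hc, h.germValue_exp hk hd, h.germExponent_eq_one hk hd, mul_one]

theorem germValue_neg_one (hk : 1 ≤ k) (hd : 1 ≤ d) (h : IsPointMap T u) (x : M) :
    germValue T u x (-1) = -1 := by
  have h1 := h.germValue_mul hk hd x (-1) (-1)
  rw [neg_one_mul, neg_neg, h.germValue_one] at h1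
  rcases mul_self_eq_one_iff.1 h1.symm with h2 | h2
  · have h3 := h.germValue_symm_germValue hk hd x (-1)
    rw [h2, h.symm.germValue_one] at h3
    norm_num at h3
  · exact h2

theorem germValue_eq (hk : 1 ≤ k) (hd : 1 ≤ d) (h : IsPointMap T u) (x : M) (c : ℝ) :
    germValue T u x c = c := by
  rcases lt_trichotomy c 0 with hc | rfl | hc
  · have h1 := h.germValue_mul hk hd x (-1) (-c)
    rwa [h.germValue_neg_one hk hd, h.germValue_of_pos hk hd x (neg_pos.2 hc), neg_one_mul,
      neg_neg] at h1
  · exact h.germValue_zero x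
  · exact h.germValue_of_pos hk hd x hc

end IsPointMap

theorem CompactlySupportedCk.exists_diffeomorph (hk : 1 ≤ k) (hd : 1 ≤ d)
    (T : CompactlySupportedCk k d M ≃* CompactlySupportedCk k d M) :
    ∃ u : M ≃ₘ^k⟮𝓡 d, 𝓡 d⟯ M, ∀ f x, (T f).1 (u x) = f.1 x := by
  obtain ⟨u, h⟩ := exists_isPointMap T
  refine ⟨⟨u.toEquiv, h.symm.contMDiff_symm hk hd, h.contMDiff_symm hk hd⟩, fun f x => ?_⟩
  exact (h.apply_eq_germValue hk hd f x).trans (h.germValue_eq hk hd x _)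

end Rigidity

/-! ### Recognising compact support multiplicatively -/

section CompactSupport

variable {k : ℕ∞} {d : ℕ} {M : Type*} [TopologicalSpace M] [T2Space M] [SecondCountableTopology M]
  [ChartedSpace (EuclideanSpace ℝ (Fin d)) M] [IsManifold (𝓡 d) k M]

open CompactlySupportedCk

theorem exists_locallyFinite_of_not_hasCompactSupport {f : M → ℝ} (hf : ¬ HasCompactSupport f)
    (d : ℕ) [ChartedSpace (EuclideanSpace ℝ (Fin d)) M] :
    ∃ (xs : ℕ → M) (V : ℕ → Set M), (∀ n, f (xs n) ≠ 0) ∧ (∀ n, V n ∈ 𝓝 (xs n)) ∧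
      LocallyFinite V ∧ Pairwise (Function.onFun Disjoint V) := by
  have : LocallyCompactSpace M := ChartedSpace.locallyCompactSpace (EuclideanSpace ℝ (Fin d)) M
  let K := CompactExhaustion.choice M
  have hout : ∀ n, ∃ x, x ∉ K n ∧ f x ≠ 0 := by
    intro n
    by_contra! h
    exact hf (HasCompactSupport.intro (K.isCompact n) h)
  -- The gap 3 makes the shells below disjoint, and `1 ≤ K.find x` keeps the truncated subtraction
  -- `K.find x - 1` strict.
  obtain ⟨xs, hxs, hlt⟩ := exists_seq_of_forall_finset_exists
    (fun x => f x ≠ 0 ∧ 1 ≤ K.find x) (fun x y => K.find x + 3 ≤ K.find y) (by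
      intro s _
      obtain ⟨x, hx, hfx⟩ := hout (s.sup K.find + 3)
      rw [K.mem_iff_find_le, not_le] at hx
      refine ⟨x, ⟨hfx, by omega⟩, fun y hy => ?_⟩
      have := Finset.le_sup (f := K.find) hy
      omega)
  have hmono : StrictMono fun n => K.find (xs n) := fun m n hmn => by
    have := hlt m n hmn
    simp only
    omega
  let V : ℕ → Set M := fun n => interior (K (K.find (xs n) + 1)) \ K (K.find (xs n) - 1)
  have hdisj : ∀ m n, m < n → Disjoint (V m) (V n) := by
    intro m n hmn
    refine disjoint_left.2 fun z hz hz' => hz'.2 ?_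
    have := hlt m n hmn
    exact K.subset (by omega) (interior_subset hz.1)
  refine ⟨xs, V, fun n => (hxs n).1, fun n => ?_, fun x => ?_, fun m n hmn => ?_⟩
  · refine (isOpen_interior.sdiff (K.isClosed _)).mem_nhds ⟨?_, ?_⟩
    · exact K.subset_interior_succ _ (K.mem_find _)
    · rw [K.mem_iff_find_le]
      have := (hxs n).2
      omega
  · refine ⟨_, isOpen_interior.mem_nhds (K.subset_interior_succ _ (K.mem_find x)),
      (finite_Iic (K.find x + 2)).subset ?_⟩
    rintro n ⟨z, hz, hz'⟩
    have h1 : ¬ K.find x + 1 ≤ K.find (xs n) - 1 := fun h =>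
      hz.2 (K.subset h (interior_subset hz'))
    have h2 : n ≤ K.find (xs n) := hmono.le_apply
    rw [mem_Iic]
    omega
  · rcases lt_or_gt_of_ne hmn with h | h
    · exact hdisj m n h
    · exact (hdisj n m h).symm

/-- Compactness of the support, expressed through multiplication alone. -/
theorem hasCompactSupport_iff_not_exists_glue (f : C^k⟮𝓡 d, M; 𝓘(ℝ, ℝ), ℝ⟯) :
    HasCompactSupport f ↔ ¬ ∃ g : ℕ → C^k⟮𝓡 d, M; 𝓘(ℝ, ℝ), ℝ⟯, (∀ n, g n * f ≠ 0) ∧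
      ∀ h : ℕ → C^k⟮𝓡 d, M; 𝓘(ℝ, ℝ), ℝ⟯, ∃ h', ∀ n, h' * g n = h n * g n := by
  constructor
  · rintro hf ⟨g, hg, hglue⟩
    have hx : ∀ n, ∃ x, g n x * f x ≠ 0 := by
      intro n
      by_contra! h
      exact hg n (ContMDiffMap.ext h)
    choose x hx using hx
    -- Gluing the constants `n` would make `h'` unbounded on the compact support of `f`.
    obtain ⟨h', hh'⟩ := hglue fun n => ⟨fun _ => (n : ℝ), contMDiff_const⟩
    have hval : ∀ n, h' (x n) = n := fun n =>
      mul_right_cancel₀ (left_ne_zero_of_mul (hx n)) (congrArg (fun φ => φ (x n)) (hh' n))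
    obtain ⟨C, hC⟩ := IsCompact.exists_bound_of_continuousOn hf h'.contMDiff.continuous.continuousOn
    obtain ⟨n, hn⟩ := exists_nat_gt C
    have := hC (x n) (subset_tsupport _ (right_ne_zero_of_mul (hx n)))
    rw [hval, Real.norm_natCast] at this
    linarith
  · intro hP
    by_contra hf
    refine hP ?_
    obtain ⟨xs, V, hfx, hV, hlf, hdisj⟩ := exists_locallyFinite_of_not_hasCompactSupport hf d
    choose e he heV using fun n => exists_bump (k := k) (d := d) (hV n)
    choose e' he' hee' using fun n => exists_mul_eq_right (he n)
    have hsupp : ∀ n z, (e n).1 z ≠ 0 → z ∈ V n := fun n z hz => heV n (subset_tsupport _ hz)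
    refine ⟨fun n => (e' n).1, fun n h0 => ?_, fun h => ?_⟩
    · have h1 : (e' n).1 (xs n) * f (xs n) = 0 := congrArg (fun φ => φ (xs n)) h0
      rw [(he' n).self_of_nhds] at h1
      simp [hfx n] at h1
    · refine ⟨⟨fun x => ∑ᶠ n, h n x * (e n).1 x, contMDiff_finsum
        (fun n => (h n).contMDiff.mul (contMDiff_coe (e n)))
        (hlf.subset fun n z hz => hsupp n z (right_ne_zero_of_mul hz))⟩,
        fun n => ContMDiffMap.ext fun z => ?_⟩
      change (∑ᶠ m, h m z * (e m).1 z) * (e' n).1 z = h n z * (e' n).1 z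
      by_cases hz : (e' n).1 z = 0
      · simp [hz]
      · have h1 : (e n).1 z = 1 := mul_right_cancel₀ hz
          ((congrArg (fun φ => φ.1 z) (hee' n)).trans (one_mul _).symm)
        rw [finsum_eq_single _ n, h1, mul_one]
        intro m hm
        by_contra h2
        exact disjoint_left.1 (hdisj hm) (hsupp m z (right_ne_zero_of_mul h2))
          (hsupp n z (by rw [h1]; exact one_ne_zero))

end CompactSupport

/-- A multiplicative bijection preserving the range of an injective multiplicative map
restricts to the source of that map. -/
theorem exists_mulEquiv_of_preserves_range {A B : Type*} [Mul B] {mul : A → A → A} {ι : B → A}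
    (hι : Function.Injective ι) (hιm : ∀ f g, ι (f * g) = mul (ι f) (ι g)) {T : A → A}
    (hT : Function.Bijective T) (hTm : ∀ f g, T (mul f g) = mul (T f) (T g))
    (hr : ∀ a, a ∈ range ι ↔ T a ∈ range ι) : ∃ S : B ≃* B, ∀ f, ι (S f) = T (ι f) := by
  choose S hS using fun f => (hr (ι f)).1 (mem_range_self f)
  let S' : B →ₙ* B := ⟨S, fun f g => hι (by rw [hS, hιm, hTm, hιm, hS, hS])⟩
  refine ⟨MulEquiv.ofBijective S' ⟨fun f g hfg => ?_, fun g => ?_⟩, hS⟩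
  · refine hι (hT.1 ?_)
    rw [← hS, ← hS]
    exact congrArg ι hfg
  · obtain ⟨a, ha⟩ := hT.2 (ι g)
    obtain ⟨f, rfl⟩ := (hr a).2 (ha ▸ mem_range_self g)
    exact ⟨f, hι ((hS f).trans ha)⟩

/-! ### Compact support among Schwartz functions -/

section Schwartz

variable {n : ℕ}

/-- Compactly supported smooth functions are Schwartz functions. -/
noncomputable def CompactlySupportedCk.toSchwartz
    (f : CompactlySupportedCk ⊤ n (EuclideanSpace ℝ (Fin n))) : 𝓢(EuclideanSpace ℝ (Fin n), ℝ) :=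
  (CompactlySupportedCk.hasCompactSupport_coe f).toSchwartzMap
    (CompactlySupportedCk.contMDiff_coe f).contDiff

theorem CompactlySupportedCk.toSchwartz_apply
    (f : CompactlySupportedCk ⊤ n (EuclideanSpace ℝ (Fin n))) (x : EuclideanSpace ℝ (Fin n)) :
    CompactlySupportedCk.toSchwartz f x = f.1 x := rfl

/-- A local unit `e` equals 1 wherever `f` is nonzero, but tends to 0 at infinity. -/
theorem mem_range_toSchwartz_iff (f : 𝓢(EuclideanSpace ℝ (Fin n), ℝ)) :
    f ∈ range (CompactlySupportedCk.toSchwartz (n := n)) ↔ ∃ e, schwartzMul e f = f := by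
  constructor
  · rintro ⟨f, rfl⟩
    obtain ⟨R, hR⟩ :=
      (CompactlySupportedCk.hasCompactSupport_coe f).isCompact.isBounded.subset_closedBall 0
    let b : ContDiffBump (0 : EuclideanSpace ℝ (Fin n)) :=
      ⟨max R 1, max R 1 + 1, by positivity, by linarith⟩
    refine ⟨b.hasCompactSupport.toSchwartzMap b.contDiff, SchwartzMap.ext fun x => ?_⟩
    rw [schwartzMul_apply, CompactlySupportedCk.toSchwartz_apply]
    by_cases hx : f.1 x = 0
    · simp [hx]
    · have : b x = 1 := b.one_of_mem_closedBall
        (Metric.closedBall_subset_closedBall (le_max_left _ _) (hR (subset_tsupport _ hx)))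
      exact (congrArg (· * f.1 x) this).trans (one_mul _)
  · rintro ⟨e, he⟩
    have hlim := (zero_at_infty e).eventually_lt_const one_pos
    obtain ⟨K, hK, hKe⟩ := mem_cocompact.1 hlim
    refine ⟨CompactlySupportedCk.mk f (f.smooth ⊤).contMDiff
      (HasCompactSupport.intro hK fun x hx => ?_), SchwartzMap.ext fun x => rfl⟩
    by_contra h0
    have h1 : e x * f x = 1 * f x := (congrArg (fun g => g x) he).trans (one_mul _).symm
    have h2 : e x < 1 := hKe hx
    exact h2.ne (mul_right_cancel₀ h0 h1)

end Schwartz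

theorem mainTheorem2 (k : ℕ∞) (hk : 1 ≤ k) (d : ℕ) (hd : 1 ≤ d)
    {M : Type*} [TopologicalSpace M] [T2Space M] [SecondCountableTopology M]
    [ChartedSpace (EuclideanSpace ℝ (Fin d)) M] [IsManifold (𝓡 d) k M] :
    -- the case `B = C^k(M, ℝ)`
    (∀ T : C^k⟮𝓡 d, M; 𝓘(ℝ, ℝ), ℝ⟯ → C^k⟮𝓡 d, M; 𝓘(ℝ, ℝ), ℝ⟯,
      Function.Bijective T → (∀ f g, T (f * g) = T f * T g) →
        (∃ u : M ≃ₘ^k⟮𝓡 d, 𝓡 d⟯ M, ∀ f x, T f (u x) = f x) ∧ IsLinearMap ℝ T) ∧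
    -- the case `B = C^k_c(M, ℝ)`
    (∀ T : CompactlySupportedCk k d M → CompactlySupportedCk k d M,
      Function.Bijective T → (∀ f g, T (f * g) = T f * T g) →
        (∃ u : M ≃ₘ^k⟮𝓡 d, 𝓡 d⟯ M, ∀ f x, (T f).1 (u x) = f.1 x) ∧ IsLinearMap ℝ T) ∧
    -- the case of real Schwartz functions, where `M = ℝ^n` and `k = ∞`
    (∀ n : ℕ, 1 ≤ n →
      ∀ T : 𝓢(EuclideanSpace ℝ (Fin n), ℝ) → 𝓢(EuclideanSpace ℝ (Fin n), ℝ),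
      Function.Bijective T → (∀ f g, T (schwartzMul f g) = schwartzMul (T f) (T g)) →
        (∃ u : EuclideanSpace ℝ (Fin n) ≃ₘ^∞⟮𝓡 n, 𝓡 n⟯ EuclideanSpace ℝ (Fin n),
          ∀ f x, T f (u x) = f x) ∧ IsLinearMap ℝ T) := by
  refine ⟨fun T hT hmul => ?_, fun T hT hmul => ?_, fun n hn T hT hmul => ?_⟩
  · have hr : ∀ f : C^k⟮𝓡 d, M; 𝓘(ℝ, ℝ), ℝ⟯,
        f ∈ range (Subtype.val : CompactlySupportedCk k d M → _) ↔
        T f ∈ range (Subtype.val : CompactlySupportedCk k d M → _) := by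
      intro f
      have hmem : ∀ f : C^k⟮𝓡 d, M; 𝓘(ℝ, ℝ), ℝ⟯,
          f ∈ range (Subtype.val : CompactlySupportedCk k d M → _) ↔ HasCompactSupport f :=
        fun f => ⟨fun ⟨g, hg⟩ => hg ▸ g.2, fun hf => ⟨⟨f, hf⟩, rfl⟩⟩
      rw [hmem, hmem, hasCompactSupport_iff_not_exists_glue, hasCompactSupport_iff_not_exists_glue]
      refine not_congr ?_
      let S : C^k⟮𝓡 d, M; 𝓘(ℝ, ℝ), ℝ⟯ ≃* C^k⟮𝓡 d, M; 𝓘(ℝ, ℝ), ℝ⟯ :=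
        MulEquiv.ofBijective (⟨T, hmul⟩ : _ →ₙ* _) hT
      have hS : T f = S f := rfl
      rw [hS]
      -- Stated for an arbitrary `R` so that it applies to both `S` and its inverse.
      have key : ∀ (R : C^k⟮𝓡 d, M; 𝓘(ℝ, ℝ), ℝ⟯ ≃* C^k⟮𝓡 d, M; 𝓘(ℝ, ℝ), ℝ⟯) (f),
          (∃ g : ℕ → C^k⟮𝓡 d, M; 𝓘(ℝ, ℝ), ℝ⟯, (∀ n, g n * f ≠ 0) ∧
            ∀ h : ℕ → C^k⟮𝓡 d, M; 𝓘(ℝ, ℝ), ℝ⟯, ∃ h', ∀ n, h' * g n = h n * g n) →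
          ∃ g : ℕ → C^k⟮𝓡 d, M; 𝓘(ℝ, ℝ), ℝ⟯, (∀ n, g n * R f ≠ 0) ∧
            ∀ h : ℕ → C^k⟮𝓡 d, M; 𝓘(ℝ, ℝ), ℝ⟯, ∃ h', ∀ n, h' * g n = h n * g n := by
        rintro R f ⟨g, hg, hglue⟩
        refine ⟨fun n => R (g n), fun n h0 => hg n ?_, fun h => ?_⟩
        · rw [← map_mul] at h0
          exact (map_eq_zero_iff R R.injective).1 h0
        · obtain ⟨h', hh'⟩ := hglue fun n => R.symm (h n)
          refine ⟨R h', fun n => ?_⟩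
          rw [← map_mul, hh', map_mul, R.apply_symm_apply]
      exact ⟨key S f, fun h => by simpa using key S.symm (S f) h⟩
    obtain ⟨S, hS⟩ := exists_mulEquiv_of_preserves_range
      (ι := (Subtype.val : CompactlySupportedCk k d M → _)) Subtype.val_injective
      (fun _ _ => rfl) hT hmul hr
    obtain ⟨u, hu⟩ := CompactlySupportedCk.exists_diffeomorph hk hd S
    -- For a bump `e` with `e x = 1`, both `f * e` and `e` are compactly supported, and `T e` equals
    -- 1 at `u x`.
    have hTu : ∀ f x, T f (u x) = f x := by
      intro f x
      obtain ⟨e, he, -⟩ := CompactlySupportedCk.exists_bump (k := k) (d := d) (univ_mem (f := 𝓝 x))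
      have hex : e.1 x = 1 := he.self_of_nhds
      have h1 : T (f * e.1) (u x) = f x * e.1 x := by
        have := hu ⟨f * e.1, (CompactlySupportedCk.hasCompactSupport_coe e).mul_left⟩ x
        rwa [hS] at this
      have h2 : T e.1 (u x) = 1 := by rw [← hS, hu, hex]
      rw [hmul, hex, mul_one] at h1
      change T f (u x) * T e.1 (u x) = f x at h1
      rwa [h2, mul_one] at h1
    refine ⟨⟨u, hTu⟩, fun f g => ContMDiffMap.ext fun y => ?_, fun c f =>
      ContMDiffMap.ext fun y => ?_⟩
    all_goals obtain ⟨x, rfl⟩ := u.surjective y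
    · change T (f + g) (u x) = T f (u x) + T g (u x)
      rw [hTu, hTu, hTu]
      rfl
    · change T (c • f) (u x) = c • T f (u x)
      rw [hTu, hTu]
      rfl
  · obtain ⟨u, hTu⟩ := CompactlySupportedCk.exists_diffeomorph hk hd
      (MulEquiv.ofBijective (⟨T, hmul⟩ : _ →ₙ* _) hT)
    replace hTu : ∀ f x, (T f).1 (u x) = f.1 x := hTu
    refine ⟨⟨u, hTu⟩, fun f g => CompactlySupportedCk.ext_apply fun y => ?_, fun c f =>
      CompactlySupportedCk.ext_apply fun y => ?_⟩
    all_goals obtain ⟨x, rfl⟩ := u.surjective y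
    · change (T (f + g)).1 (u x) = (T f).1 (u x) + (T g).1 (u x)
      rw [hTu, hTu, hTu]
      rfl
    · change (T (c • f)).1 (u x) = c • (T f).1 (u x)
      rw [hTu, hTu]
      rfl
  · have hr : ∀ f, f ∈ range (CompactlySupportedCk.toSchwartz (n := n)) ↔
        T f ∈ range (CompactlySupportedCk.toSchwartz (n := n)) := by
      intro f
      rw [mem_range_toSchwartz_iff, mem_range_toSchwartz_iff]
      constructor
      · rintro ⟨e, he⟩
        exact ⟨T e, by rw [← hmul, he]⟩
      · rintro ⟨e, he⟩
        obtain ⟨e, rfl⟩ := hT.2 e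
        exact ⟨e, hT.1 (by rw [hmul, he])⟩
    obtain ⟨S, hS⟩ := exists_mulEquiv_of_preserves_range
      (ι := CompactlySupportedCk.toSchwartz (n := n))
      (fun f g hfg => CompactlySupportedCk.ext_apply fun x => congrArg (fun φ => φ x) hfg)
      (fun _ _ => SchwartzMap.ext fun _ => rfl) hT hmul hr
    obtain ⟨u, hu⟩ := CompactlySupportedCk.exists_diffeomorph le_top hn S
    have hu' : ∀ (f : CompactlySupportedCk ⊤ n (EuclideanSpace ℝ (Fin n))) x,
        T (CompactlySupportedCk.toSchwartz f) (u x) = f.1 x := fun f x => by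
      rw [← hS]
      exact hu f x
    have hTu : ∀ f x, T f (u x) = f x := by
      intro f x
      obtain ⟨e, he, -⟩ := CompactlySupportedCk.exists_bump (k := ⊤) (d := n)
        (univ_mem (f := 𝓝 x))
      have hex : e.1 x = 1 := he.self_of_nhds
      have h1 := hu' (CompactlySupportedCk.mk (fun y => f y * e.1 y)
        ((f.smooth ⊤).contMDiff.mul (CompactlySupportedCk.contMDiff_coe e))
        (CompactlySupportedCk.hasCompactSupport_coe e).mul_left) x
      have h2 : CompactlySupportedCk.toSchwartz (CompactlySupportedCk.mk (fun y => f y * e.1 y)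
          ((f.smooth ⊤).contMDiff.mul (CompactlySupportedCk.contMDiff_coe e))
          (CompactlySupportedCk.hasCompactSupport_coe e).mul_left) =
          schwartzMul f (CompactlySupportedCk.toSchwartz e) := SchwartzMap.ext fun _ => rfl
      rw [h2, hmul, schwartzMul_apply, hu', CompactlySupportedCk.mk_apply, hex, mul_one,
        mul_one] at h1
      exact h1
    refine ⟨⟨u, hTu⟩, fun f g => SchwartzMap.ext fun y => ?_, fun c f =>
      SchwartzMap.ext fun y => ?_⟩
    all_goals obtain ⟨x, rfl⟩ := u.surjective y
    · change T (f + g) (u x) = T f (u x) + T g (u x)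
      rw [hTu, hTu, hTu]
      rfl
    · change T (c • f) (u x) = c • T f (u x)
      rw [hTu, hTu]
      rfl
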